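/- A (generalized) mean is a positive continuous function $M$ on $(0,\infty)\times(0,\infty)$ such that for all $a,b>0$: (i) $M(a,b)=M(b,a)$; (ii) $M(ra,rb)=rM(a,b)$ for all $r>0$; (iii) $M(a,b)$ is monotone increasing in $a$ and in $b$; (iv) if $a\le b$ then $a\le M(a,b)\le b$. Let $J_{2n}=\begin{bmatrix}0&I_n\\-I_n&0\end{bmatrix}$; a real $2n\times 2n$ matrix $W$ is symplectic if $W^\top J_{2n}W=J_{2n}$. For a real (symmetric) positive definite $2n\times 2n$ matrix $A$, the vector $\delta(A)=(\delta_1,\ldots,\delta_n)$ of symplectic eigenvalues of $A$ is the vector with $\delta_1\le\cdots\le\delta_n$ such that $A=W(D\oplus D)W^\top$ for some symplectic $W$, where $D=\mathrm{diag}(\delta_1,\ldots,\delta_n)$. For $x\in\mathbb R^n$ let $x_1^\uparrow\le\cdots\le x_n^\uparrow$ be its entries in increasing order. For $x,y\in\mathbb R^n$, $x$ is weakly supermajorized by $y$, written $x\prec^w y$, if $\sum_{j=1}^k x_j^\uparrow\ge\sum_{j=1}^k y_j^\uparrow$ for all $k=1,\ldots,n$. **Theorem.** Let $M$ be a mean such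 that $\sqrt{ab}\le M(a,b)$ for all $a,b>0$, and let $A=[a_{ij}]$ be a real positive definite $2n\times 2n$ matrix. Then the vector $\delta(A)$ of symplectic eigenvalues of $A$ exists, and the symplectic diagonal $\mathrm{diag}_M(A)=[M(a_{ii},a_{n+i,n+i})]_{i=1}^n$ satisfies $\mathrm{diag}_M(A)\prec^w\delta(A)$. -/

import Mathlib

namespace SymplecticSchur

/-- A (generalized) mean: a positive continuous function on `(0,∞) × (0,∞)` that is symmetric,
positively homogeneous, (weakly) increasing in each variable, and lies between its arguments.
Only the values of `M` at positive arguments matter. -/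
structure IsMean (M : ℝ → ℝ → ℝ) : Prop where
  pos : ∀ a b, 0 < a → 0 < b → 0 < M a b
  continuousOn : ContinuousOn (fun p : ℝ × ℝ => M p.1 p.2) (Set.Ioi 0 ×ˢ Set.Ioi 0)
  symm : ∀ a b, 0 < a → 0 < b → M a b = M b a
  homogeneous : ∀ r a b, 0 < r → 0 < a → 0 < b → M (r * a) (r * b) = r * M a b
  mono_left : ∀ a a' b, 0 < a → a ≤ a' → 0 < b → M a b ≤ M a' b
  mono_right : ∀ a b b', 0 < a → 0 < b → b ≤ b' → M a b ≤ M a b'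
  between : ∀ a b, 0 < a → a ≤ b → a ≤ M a b ∧ M a b ≤ b

/-- The entries of `x` rearranged in increasing order. -/
noncomputable def increasing {n : ℕ} (x : Fin n → ℝ) : Fin n → ℝ :=
  x ∘ Tuple.sort x

/-- `x ≺^w y`: for every `k = 1, …, n`, the sum of the `k` smallest entries of `x` is at least the
sum of the `k` smallest entries of `y`. -/
def WeaklySupermajorizedBy {n : ℕ} (x y : Fin n → ℝ) : Prop :=
  ∀ k : ℕ, 1 ≤ k → k ≤ n →
    ∑ j : Fin n with j.val < k, increasing y j ≤ ∑ j : Fin n with j.val < k, increasing x j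

/-- The symplectic diagonal of a `2n × 2n` matrix associated with `M`. The `2n` indices are
`Fin n ⊕ Fin n`, so `Sum.inl i` is the index `i` and `Sum.inr i` is the index `n + i`. -/
def sympDiag {n : ℕ} (M : ℝ → ℝ → ℝ) (A : Matrix (Fin n ⊕ Fin n) (Fin n ⊕ Fin n) ℝ) :
    Fin n → ℝ :=
  fun i => M (A (Sum.inl i) (Sum.inl i)) (A (Sum.inr i) (Sum.inr i))

/-- `δ` is the vector `δ(A)` of symplectic eigenvalues of `A` in increasing order:
`A = W (D ⊕ D) Wᵀ` with `W` symplectic and `D = diag(δ₁, …, δₙ)`, `δ₁ ≤ … ≤ δₙ`.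
(Mathlib defines symplectic by `W J Wᵀ = J`, which is equivalent to `Wᵀ J W = J`, and its `J` is
the negative of `[[0, I], [-I, 0]]`, which gives the same matrices `W`.) -/
def IsSymplecticEigenvalueVector {n : ℕ} (A : Matrix (Fin n ⊕ Fin n) (Fin n ⊕ Fin n) ℝ)
    (δ : Fin n → ℝ) : Prop :=
  Monotone δ ∧ ∃ W ∈ Matrix.symplecticGroup (Fin n) ℝ,
    A = W * Matrix.fromBlocks (Matrix.diagonal δ) 0 0 (Matrix.diagonal δ) * W.transpose

end SymplecticSchur

/-!
Existence of the symplectic eigenvalues is Williamson's theorem. Write `A = Bᵀ B`. The matrix `K =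
B J Bᵀ` is skew-symmetric and invertible, so `i K` is Hermitian with nonzero eigenvalues, and its
eigenvectors come in conjugate pairs belonging to opposite eigenvalues. Exactly `n` eigenvalues
are therefore positive, and the real and imaginary parts of their eigenvectors form the columns of
an orthogonal matrix `O` with `Oᵀ K O = J (D ⊕ D)` (`exists_orthogonal_skew_normal_form`). Then `W
= Bᵀ O (D ⊕ D)^(-1/2)` is symplectic and `A = W (D ⊕ D) Wᵀ`.

The inequality follows from a trace bound: if `A = W (D ⊕ D) Wᵀ` with `W` symplectic, then for a
set `T` of `k` indices, twice the sum of the `k` smallest `δᵢ` is at most `∑ j ∈ T, (a_{jj} +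
a_{n+j,n+j})` (`two_mul_sum_smallest_le_trace`). Rows `j` and `n + j` of `W` are the real and
imaginary part of a complex vector, which splits into components in the positive and the negative
eigenspace of `i J`. These components give complex `n × n` matrices `F` and `E`, and the
symplectic relation becomes `F Fᴴ = 1 + E Eᴴ`. For the rows in `T` the matrix `F_T F_Tᴴ` is thus
at least `1`, so the orthogonal projection `F_Tᴴ (F_T F_Tᴴ)⁻¹ F_T` of rank `k` lies below `F_Tᴴ
F_T`. Its diagonal entries are weights `qᵢ ∈ [0, 1]` of total `k` with `∑ᵢ δᵢ qᵢ` at most half the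
trace, and such a weighted sum is at least the sum of the `k` smallest `δᵢ`.

Replacing `A` by `L A Lᵀ` with `L` diagonal and symplectic leaves `δ` unchanged and turns both
`a_{jj}` and `a_{n+j,n+j}` into their geometric mean (`sum_smallest_le_sum_sqrt`); a mean that
dominates the geometric mean only enlarges the right-hand side.
-/

namespace SymplecticSchur

open Matrix

open scoped ComplexOrder

/-! ### Real orthonormal columns from complex eigenvectors of a skew-symmetric matrix -/

section RealParts

variable {m p : Type*}

/-- The real matrix whose columns are the real parts of the columns of `Z`, followed by their
imaginary parts. The factor `√2` makes them unit vectors when the columns of `Z` are orthonormal and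
orthogonal to their conjugates. -/
noncomputable def realCols (Z : Matrix m p ℂ) : Matrix m (p ⊕ p) ℝ :=
  fromCols (√2 • Z.map Complex.re) (√2 • Z.map Complex.im)

variable [Fintype m] [DecidableEq p]

theorem realCols_transpose_mul_self {Z : Matrix m p ℂ} (h₁ : Zᴴ * Z = 1) (h₂ : Zᵀ * Z = 0) :
    (realCols Z)ᵀ * realCols Z = 1 := by
  have e₁ (i j : p) := congrFun₂ h₁ i j
  have e₂ (i j : p) := congrFun₂ h₂ i j
  have hs : √2 * √2 = 2 := Real.mul_self_sqrt (by norm_num)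
  have hone (i j : p) : ((1 : Matrix p p ℂ) i j).re = (1 : Matrix p p ℝ) i j ∧
      ((1 : Matrix p p ℂ) i j).im = 0 := by
    by_cases h : i = j <;> simp [one_apply, h]
  have hc (f g : m → ℝ) : ∑ k, √2 * f k * (√2 * g k) = 2 * ∑ k, f k * g k := by
    rw [Finset.mul_sum]
    exact Finset.sum_congr rfl fun k _ => by rw [mul_mul_mul_comm, hs]
  rw [realCols, transpose_fromCols, fromRows_mul_fromCols, ← fromBlocks_one]
  have key (i j : p) := And.intro (congrArg Complex.re (e₁ i j)) (And.intro
    (congrArg Complex.im (e₁ i j)) (And.intro (congrArg Complex.re (e₂ i j))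
      (congrArg Complex.im (e₂ i j))))
  simp only [mul_apply, conjTranspose_apply, transpose_apply, Complex.re_sum, Complex.im_sum,
    Complex.mul_re, Complex.mul_im, (hone _ _).1, (hone _ _).2, Matrix.zero_apply, Complex.zero_re,
    Complex.zero_im, RCLike.star_def, Complex.conj_re, Complex.conj_im, Finset.sum_sub_distrib,
    Finset.sum_add_distrib, neg_mul, sub_neg_eq_add, Finset.sum_neg_distrib] at key
  congr 1 <;> ext i j <;> obtain ⟨k1, k2, k3, k4⟩ := key i j <;>
    simp only [mul_apply, transpose_apply, Matrix.smul_apply, map_apply, smul_eq_mul, Matrix.zero_apply,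
      hc] <;> linarith

variable [Fintype p]

/-- Orthonormal vectors that are orthogonal to all their conjugates number at most half the dimension. -/
theorem card_le_of_unitary_cols {Z : Matrix m p ℂ} (h₁ : Zᴴ * Z = 1) (h₂ : Zᵀ * Z = 0) :
    Fintype.card p + Fintype.card p ≤ Fintype.card m := by
  have h := realCols_transpose_mul_self h₁ h₂
  have := rank_mul_le_right (realCols Z)ᵀ (realCols Z)
  rw [h, rank_one, Fintype.card_sum] at this
  exact this.trans (rank_le_card_height _)

/-- Eigenvectors of `i K`, with `K` real skew-symmetric, are orthogonal to each other's conjugates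
if no two of the eigenvalues (possibly equal) add up to zero: conjugation negates the eigenvalue. -/
theorem transpose_mul_self_eq_zero_of_skew {K : Matrix m m ℝ} (hK : Kᵀ = -K) {Z : Matrix m p ℂ}
    {d : p → ℝ} (hZ : (Complex.I • K.map Complex.ofReal) * Z = Z * diagonal fun i => (d i : ℂ))
    (hd : ∀ i j, d i + d j ≠ 0) : Zᵀ * Z = 0 := by
  have hKt : (K.map Complex.ofReal)ᵀ = -K.map Complex.ofReal := by
    rw [← transpose_map, hK]; ext; simp
  have h : (diagonal fun i => (d i : ℂ)) * (Zᵀ * Z) = -(Zᵀ * Z * diagonal fun i => (d i : ℂ)) := by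
    have := congrArg transpose hZ
    rw [transpose_mul, transpose_mul, diagonal_transpose, transpose_smul, hKt] at this
    rw [← Matrix.mul_assoc, ← this, Matrix.mul_assoc Zᵀ, Matrix.mul_assoc Zᵀ, ← hZ]
    simp
  ext i j
  have := congrFun₂ h i j
  rw [diagonal_mul, Matrix.neg_apply, mul_diagonal] at this
  have h' : ((d i + d j : ℝ) : ℂ) * (Zᵀ * Z) i j = 0 := by push_cast; linear_combination this
  exact (mul_eq_zero.mp h').resolve_left (by exact_mod_cast hd i j)

theorem realCols_transpose_mul_skew_mul {K : Matrix m m ℝ} {Z : Matrix m p ℂ}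
    {d : p → ℝ} (hZ : (Complex.I • K.map Complex.ofReal) * Z = Z * diagonal fun i => (d i : ℂ))
    (h₁ : Zᴴ * Z = 1) (h₂ : Zᵀ * Z = 0) :
    (realCols Z)ᵀ * K * realCols Z = J p ℝ * fromBlocks (diagonal d) 0 0 (diagonal d) := by
  have key (i : m) (j : p) := congrFun₂ hZ i j
  have hneg : Z.map Complex.re * (diagonal fun i => -d i) = -(Z.map Complex.re * diagonal d) := by
    rw [← diagonal_neg, Matrix.mul_neg]
  have hre : K * Z.map Complex.re = Z.map Complex.im * diagonal d := by
    ext i j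
    have := congrArg Complex.im (key i j)
    simpa [mul_apply, mul_diagonal, diagonal_apply] using this
  have him : K * Z.map Complex.im = -(Z.map Complex.re * diagonal d) := by
    ext i j
    have := congrArg Complex.re (key i j)
    simp [mul_apply, diagonal_apply] at this ⊢
    linarith
  have hcol : K * realCols Z =
      realCols Z * (J p ℝ * fromBlocks (diagonal d) 0 0 (diagonal d)) := by
    rw [realCols, mul_fromCols, J, fromBlocks_multiply, fromCols_mul_fromBlocks]
    simp [hre, him, hneg]
  rw [Matrix.mul_assoc, hcol, ← Matrix.mul_assoc, realCols_transpose_mul_self h₁ h₂,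
    Matrix.one_mul]

end RealParts

/-! ### Williamson's theorem -/

/-- Orthogonal normal form of an invertible real skew-symmetric matrix of even size. -/
theorem exists_orthogonal_skew_normal_form {n : ℕ} {K : Matrix (Fin n ⊕ Fin n) (Fin n ⊕ Fin n) ℝ}
    (hK : Kᵀ = -K) (hdet : K.det ≠ 0) :
    ∃ (d : Fin n → ℝ) (O : Matrix (Fin n ⊕ Fin n) (Fin n ⊕ Fin n) ℝ),
      Monotone d ∧ (∀ i, 0 < d i) ∧ Oᵀ * O = 1 ∧
        Oᵀ * K * O = J (Fin n) ℝ * fromBlocks (diagonal d) 0 0 (diagonal d) := by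
  set H : Matrix (Fin n ⊕ Fin n) (Fin n ⊕ Fin n) ℂ := Complex.I • K.map Complex.ofReal with hHdef
  have hH : H.IsHermitian := by
    ext i j
    have := congrFun₂ hK i j
    simp only [transpose_apply, Matrix.neg_apply] at this
    simp [hHdef, this]
  have hHdet : H.det ≠ 0 := by
    rw [hHdef, det_smul]
    refine mul_ne_zero (pow_ne_zero _ Complex.I_ne_zero) ?_
    have : (K.map Complex.ofReal).det = ((K.det : ℝ) : ℂ) :=
      (RingHom.map_det Complex.ofRealHom K).symm
    rw [this]; exact_mod_cast hdet
  have hev (i) : hH.eigenvalues i ≠ 0 := by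
    rw [hH.det_eq_prod_eigenvalues, Finset.prod_ne_zero_iff] at hHdet
    exact fun h => hHdet i (Finset.mem_univ i) (by simp [h])
  set U : Matrix (Fin n ⊕ Fin n) (Fin n ⊕ Fin n) ℂ := hH.eigenvectorUnitary.1 with hUdef
  have hUU : Uᴴ * U = 1 := Unitary.coe_star_mul_self hH.eigenvectorUnitary
  have hHU : H * U = U * diagonal fun i => (hH.eigenvalues i : ℂ) := by
    have h := hH.spectral_theorem
    rw [Unitary.conjStarAlgAut_apply] at h
    nth_rw 1 [h]
    rw [Matrix.mul_assoc, Unitary.coe_star_mul_self, Matrix.mul_one]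
    rfl
  -- Any injective selection of columns of `U` consists of orthonormal eigenvectors
  have sel {p : Type} [Fintype p] [DecidableEq p] (e : p → Fin n ⊕ Fin n)
      (he : Function.Injective e) :
      (U.submatrix id e)ᴴ * U.submatrix id e = 1 ∧ H * U.submatrix id e =
        U.submatrix id e * diagonal fun i => (hH.eigenvalues (e i) : ℂ) := by
    constructor
    · have : (U.submatrix id e)ᴴ * U.submatrix id e = (Uᴴ * U).submatrix e e := rfl
      rw [this, hUU, submatrix_one _ he]
    · ext i j
      have := congrFun₂ hHU i (e j)
      rw [mul_diagonal] at this ⊢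
      exact this
  have hcard (P : Fin n ⊕ Fin n → Prop) [DecidablePred P]
      (hP : ∀ i j, P i → P j → hH.eigenvalues i + hH.eigenvalues j ≠ 0) :
      Fintype.card {i // P i} ≤ n := by
    obtain ⟨h₁, h₂⟩ := sel (Subtype.val : {i // P i} → _) Subtype.val_injective
    have := card_le_of_unitary_cols h₁
      (transpose_mul_self_eq_zero_of_skew hK h₂ fun i j => hP i j i.2 j.2)
    simp only [Fintype.card_sum, Fintype.card_fin] at this
    omega
  -- Neither the positive nor the negative eigenvalues exceed `n` in number; there are `2n` in all.
  have hpos := hcard (fun i => 0 < hH.eigenvalues i) fun i j hi hj => by positivity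
  have hneg := hcard (fun i => ¬ 0 < hH.eigenvalues i) fun i j hi hj => by
    have hi' := lt_of_le_of_ne (not_lt.mp hi) (hev i)
    have hj' := lt_of_le_of_ne (not_lt.mp hj) (hev j)
    exact (add_neg hi' hj').ne
  have htot := Fintype.card_subtype_compl (fun i => 0 < hH.eigenvalues i)
  simp only [Fintype.card_sum, Fintype.card_fin] at htot
  have hn : Fintype.card {i // 0 < hH.eigenvalues i} = Fintype.card (Fin n) := by
    rw [Fintype.card_fin]; omega
  set e₀ : Fin n ≃ {i // 0 < hH.eigenvalues i} := (Fintype.equivOfCardEq hn).symm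
  set f : Fin n → ℝ := fun i => hH.eigenvalues (e₀ i)
  set e : Fin n → Fin n ⊕ Fin n := fun i => e₀ (Tuple.sort f i)
  have hd (i) : 0 < hH.eigenvalues (e i) := (e₀ (Tuple.sort f i)).2
  obtain ⟨h₁, h₂⟩ := sel e (Subtype.val_injective.comp (e₀.injective.comp (Equiv.injective _)))
  have h₃ := transpose_mul_self_eq_zero_of_skew hK h₂ fun i j => (add_pos (hd i) (hd j)).ne'
  exact ⟨fun i => hH.eigenvalues (e i), realCols (U.submatrix id e), Tuple.monotone_sort f, hd,
    realCols_transpose_mul_self h₁ h₃, realCols_transpose_mul_skew_mul h₂ h₁ h₃⟩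

open scoped MatrixOrder in
/-- **Williamson's theorem**. -/
theorem exists_isSymplecticEigenvalueVector {n : ℕ}
    {A : Matrix (Fin n ⊕ Fin n) (Fin n ⊕ Fin n) ℝ} (hA : A.PosDef) :
    ∃ δ : Fin n → ℝ, IsSymplecticEigenvalueVector A δ := by
  obtain ⟨B, hB⟩ := CStarAlgebra.nonneg_iff_eq_star_mul_self.mp hA.posSemidef.nonneg
  rw [star_eq_conjTranspose, conjTranspose_eq_transpose_of_trivial] at hB
  have hBdet : B.det ≠ 0 := by
    intro h
    have := hA.det_pos
    rw [hB, det_mul, h, mul_zero] at this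
    exact this.false
  have hJ : (J (Fin n) ℝ).det ≠ 0 := (isUnit_det_J (Fin n) ℝ).ne_zero
  obtain ⟨d, O, hmono, hd, hO, hK⟩ := exists_orthogonal_skew_normal_form
    (K := B * J (Fin n) ℝ * Bᵀ) (by simp [Matrix.mul_assoc])
    (by rw [det_mul, det_mul, det_transpose]; exact mul_ne_zero (mul_ne_zero hBdet hJ) hBdet)
  have hOO : O * Oᵀ = 1 := mul_eq_one_comm.mp hO
  set s : Fin n → ℝ := fun i => (√(d i))⁻¹
  set S : Matrix (Fin n ⊕ Fin n) (Fin n ⊕ Fin n) ℝ := fromBlocks (diagonal s) 0 0 (diagonal s)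
    with hS
  have hss (i : Fin n) : s i * (d i * s i) = 1 := by
    have h := Real.mul_self_sqrt (hd i).le
    have h0 := (Real.sqrt_pos.mpr (hd i)).ne'
    simp only [s]; field_simp; linarith
  have hST : Sᵀ = S := by simp [hS]
  refine ⟨d, hmono, Bᵀ * O * S, ?_, ?_⟩
  · rw [SymplecticGroup.mem_iff']
    calc (Bᵀ * O * S)ᵀ * J (Fin n) ℝ * (Bᵀ * O * S)
        = S * (Oᵀ * (B * J (Fin n) ℝ * Bᵀ) * O) * S := by
          simp only [transpose_mul, transpose_transpose, hST, Matrix.mul_assoc]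
      _ = J (Fin n) ℝ := by
          have hneg : (diagonal fun i => -(s i * d i * s i)) = -1 := by
            simp only [mul_assoc, hss]
            rw [← diagonal_neg, diagonal_one]
          rw [hK, hS, J]
          simp [fromBlocks_multiply, -fromBlocks_diagonal, hneg]
          simp only [mul_assoc, hss]
          rfl
  · calc A = Bᵀ * (O * Oᵀ) * B := by rw [hOO, Matrix.mul_one, hB]
      _ = Bᵀ * O * (S * fromBlocks (diagonal d) 0 0 (diagonal d) * S) * Oᵀ * B := by
          have : S * fromBlocks (diagonal d) 0 0 (diagonal d) * S = 1 := by
            rw [hS]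
            simp [fromBlocks_multiply, mul_assoc, hss, -fromBlocks_diagonal]
          rw [this]
          simp only [Matrix.mul_one, Matrix.mul_assoc]
      _ = _ := by
          simp only [transpose_mul, transpose_transpose, hST, Matrix.mul_assoc]

/-! ### Weights below the columns of a matrix with `F Fᴴ ≥ 1` -/

/-- The squared column norms of `F` dominate weights in `[0, 1]` whose sum is the number of rows,
as soon as `F Fᴴ ≥ 1`. The weights are the diagonal entries of the projection onto the
range of `Fᴴ`. -/
theorem exists_weights_le_col_normSq {s m : Type*} [Fintype s] [DecidableEq s] [Fintype m]
    [DecidableEq m] {F E : Matrix s m ℂ} (h : F * Fᴴ = 1 + E * Eᴴ) :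
    ∃ q : m → ℝ, (∀ i, 0 ≤ q i) ∧ (∀ i, q i ≤ 1) ∧ ∑ i, q i = Fintype.card s ∧
      ∀ i, q i ≤ ∑ j, Complex.normSq (F j i) := by
  set N := E * Eᴴ with hN
  have hNpos : N.PosSemidef := posSemidef_self_mul_conjTranspose E
  have hG : (1 + N).PosDef := PosDef.one.add_posSemidef hNpos
  have hunit : IsUnit (1 + N).det := (isUnit_iff_isUnit_det _).mp hG.isUnit
  set B := (1 + N)⁻¹ with hBdef
  have hBpos : B.PosSemidef := hG.inv.posSemidef
  have hBh : Bᴴ = B := hBpos.isHermitian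
  have hGB : (1 + N) * B = 1 := mul_nonsing_inv _ hunit
  have hBG : B * (1 + N) = 1 := nonsing_inv_mul _ hunit
  set Q := Fᴴ * B * F with hQ
  have hQpos : Q.PosSemidef := by
    simpa [hQ] using hBpos.conjTranspose_mul_mul_same F
  have hQQ : Q * Q = Q := by
    calc Q * Q = Fᴴ * (B * (F * Fᴴ)) * B * F := by simp only [hQ, Matrix.mul_assoc]
      _ = Q := by rw [h, hBG, Matrix.mul_one]
  have h1Q : (1 - Q).PosSemidef := by
    have : 1 - Q = (1 - Q)ᴴ * (1 - Q) := by
      rw [conjTranspose_sub, conjTranspose_one, hQpos.isHermitian.eq]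
      simp [Matrix.sub_mul, Matrix.mul_sub, hQQ]
    rw [this]; exact posSemidef_conjTranspose_mul_self _
  -- `1 - B = B (N + N²) B`, which makes its positivity visible since `B` is Hermitian.
  have h1B : (1 - B).PosSemidef := by
    have : 1 - B = Bᴴ * (N + N * Nᴴ) * B := by
      have hNB : N * B = 1 - B := by rw [← hGB]; simp [Matrix.add_mul]
      calc 1 - B = B * (1 + N) * (N * B) := by rw [hBG, Matrix.one_mul, hNB]
        _ = _ := by
          rw [hBh, hNpos.isHermitian.eq]
          simp only [Matrix.mul_add, Matrix.add_mul, Matrix.mul_one, Matrix.mul_assoc]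
    rw [this]
    exact (hNpos.add (posSemidef_self_mul_conjTranspose N)).conjTranspose_mul_mul_same B
  have hFF : (Fᴴ * F - Q).PosSemidef := by
    have : Fᴴ * F - Q = Fᴴ * (1 - B) * F := by
      simp [hQ, Matrix.mul_sub, Matrix.sub_mul]
    rw [this]; exact h1B.conjTranspose_mul_mul_same F
  refine ⟨fun i => (Q i i).re, fun i => (Complex.le_def.mp hQpos.diag_nonneg).1, fun i => ?_, ?_,
    fun i => ?_⟩
  · have := (Complex.le_def.mp (h1Q.diag_nonneg (i := i))).1
    simpa using this
  · have htr : Q.trace = Fintype.card s := by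
      rw [hQ, Matrix.mul_assoc, trace_mul_comm, Matrix.mul_assoc, h, hBG, trace_one]
    have := congrArg Complex.re htr
    simpa [trace] using this
  · have := (Complex.le_def.mp (hFF.diag_nonneg (i := i))).1
    simpa [mul_apply, Complex.normSq_apply] using this

theorem sum_smallest_le_sum_weights {n k : ℕ} (hk : k ≤ n) {δ q : Fin n → ℝ} (hδ : Monotone δ)
    (h0 : ∀ i, 0 ≤ q i) (h1 : ∀ i, q i ≤ 1) (hsum : ∑ i, q i = k) :
    ∑ j : Fin n with j.val < k, δ j ≤ ∑ i, δ i * q i := by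
  rcases Nat.eq_zero_or_pos k with rfl | hk0
  · have : ∀ i, q i = 0 := by
      simpa [Finset.sum_eq_zero_iff_of_nonneg fun i _ => h0 i] using hsum
    simp [this]
  -- Compare both sides after subtracting `c`, the `k`-th smallest entry; both weights have total `k`.
  set c := δ ⟨k - 1, by omega⟩ with hc
  have hcard : ∑ j : Fin n, (if j.val < k then (1 : ℝ) else 0) = k := by
    rw [Finset.sum_boole]
    simp [Fin.card_filter_val_lt, hk]
  have hterm (i : Fin n) : (if i.val < k then δ i else 0) - c * (if i.val < k then 1 else 0) ≤
      δ i * q i - c * q i := by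
    split_ifs with hi
    · have : δ i ≤ c := hδ (Fin.mk_le_mk.mpr (by omega) : i ≤ ⟨k - 1, _⟩)
      nlinarith [h1 i]
    · have : c ≤ δ i := hδ (Fin.mk_le_mk.mpr (by omega) : ⟨k - 1, _⟩ ≤ i)
      nlinarith [h0 i]
  have := Finset.sum_le_sum fun i (_ : i ∈ Finset.univ) => hterm i
  rw [Finset.sum_sub_distrib, Finset.sum_sub_distrib, ← Finset.mul_sum, ← Finset.mul_sum, hcard,
    hsum] at this
  rw [Finset.sum_filter]
  linarith

/-! ### The symplectic trace bound -/

/-- The complex form of the symplectic relation. With `W` in blocks `P, Q, R, S`, the matrices are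
`F = ((P + S) + i (R - Q)) / 2` and `E = ((P - S) + i (R + Q)) / 2`; the bound on `F` drops the term
`2 |E j i| ^ 2`, which would give equality. -/
theorem complex_halves_of_symplectic {n : ℕ} {W : Matrix (Fin n ⊕ Fin n) (Fin n ⊕ Fin n) ℝ}
    (hW : W ∈ symplecticGroup (Fin n) ℝ) :
    ∃ F E : Matrix (Fin n) (Fin n) ℂ, F * Fᴴ = 1 + E * Eᴴ ∧
      ∀ j i, 2 * Complex.normSq (F j i) ≤ W (.inl j) (.inl i) ^ 2 + W (.inl j) (.inr i) ^ 2 +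
        (W (.inr j) (.inl i) ^ 2 + W (.inr j) (.inr i) ^ 2) := by
  obtain ⟨P, Q, R, S, rfl⟩ : ∃ P Q R S, W = fromBlocks P Q R S :=
    ⟨_, _, _, _, (fromBlocks_toBlocks W).symm⟩
  have h := SymplecticGroup.mem_iff.mp hW
  rw [J, fromBlocks_multiply, fromBlocks_transpose, fromBlocks_multiply, fromBlocks_inj] at h
  obtain ⟨hPQ, hPS, hSP, hRS⟩ := h
  refine ⟨of fun j i => ⟨(P j i + S j i) / 2, (R j i - Q j i) / 2⟩,
    of fun j i => ⟨(P j i - S j i) / 2, (R j i + Q j i) / 2⟩, ?_, fun j i => ?_⟩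
  · rw [← sub_eq_iff_eq_add]
    ext j l
    have h12 := congrFun₂ hPS j l
    have h21 := congrFun₂ hSP j l
    have h11 := congrFun₂ hPQ j l
    have h22 := congrFun₂ hRS j l
    simp [mul_apply] at h11 h12 h21 h22
    have hone : (1 : Matrix (Fin n) (Fin n) ℂ) j l =
        ((1 : Matrix (Fin n) (Fin n) ℝ) j l : ℝ) := by
      by_cases h : j = l <;> simp [one_apply, h]
    rw [hone, Matrix.sub_apply, mul_apply, mul_apply, ← Finset.sum_sub_distrib]
    apply Complex.ext
    · rw [Complex.re_sum, Complex.ofReal_re]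
      trans ∑ i, 1 / 2 * (S j i * P l i - R j i * Q l i - (Q j i * R l i - P j i * S l i))
      · refine Finset.sum_congr rfl fun i _ => ?_
        simp
        ring
      · simp only [← Finset.mul_sum, Finset.sum_sub_distrib]
        linarith
    · rw [Complex.im_sum, Complex.ofReal_im]
      trans ∑ i, 1 / 2 * (R j i * S l i - S j i * R l i - (Q j i * P l i - P j i * Q l i))
      · refine Finset.sum_congr rfl fun i _ => ?_
        simp
        ring
      · simp only [← Finset.mul_sum, Finset.sum_sub_distrib]
        linarith
  · simp only [Complex.normSq_apply, of_apply, fromBlocks_apply₁₁, fromBlocks_apply₁₂,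
      fromBlocks_apply₂₁, fromBlocks_apply₂₂]
    nlinarith [sq_nonneg (P j i - S j i), sq_nonneg (R j i + Q j i)]

theorem diag_symplectic_congr {n : ℕ} (W : Matrix (Fin n ⊕ Fin n) (Fin n ⊕ Fin n) ℝ)
    (δ : Fin n → ℝ) (a : Fin n ⊕ Fin n) :
    (W * fromBlocks (diagonal δ) 0 0 (diagonal δ) * Wᵀ) a a =
      ∑ i, δ i * (W a (.inl i) ^ 2 + W a (.inr i) ^ 2) := by
  rw [fromBlocks_diagonal, mul_apply, Fintype.sum_sum_type, ← Finset.sum_add_distrib]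
  refine Finset.sum_congr rfl fun i _ => ?_
  simp only [mul_diagonal, transpose_apply, Sum.elim_inl, Sum.elim_inr]
  ring

/-- The trace of `A = W (D ⊕ D) Wᵀ` over the index pairs `j, n + j` with `j ∈ T` is at least twice
the sum of the `|T|` smallest symplectic eigenvalues. -/
theorem two_mul_sum_smallest_le_trace {n : ℕ} {W : Matrix (Fin n ⊕ Fin n) (Fin n ⊕ Fin n) ℝ}
    (hW : W ∈ symplecticGroup (Fin n) ℝ) {δ : Fin n → ℝ} (hδ : Monotone δ) (h0 : ∀ i, 0 ≤ δ i)
    (T : Finset (Fin n)) :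
    2 * ∑ j : Fin n with j.val < T.card, δ j ≤
      ∑ j ∈ T, ((W * fromBlocks (diagonal δ) 0 0 (diagonal δ) * Wᵀ) (.inl j) (.inl j) +
        (W * fromBlocks (diagonal δ) 0 0 (diagonal δ) * Wᵀ) (.inr j) (.inr j)) := by
  obtain ⟨F, E, hFE, hF⟩ := complex_halves_of_symplectic hW
  have hT : F.submatrix (Subtype.val : T → Fin n) id *
      (F.submatrix (Subtype.val : T → Fin n) id)ᴴ = 1 +
        E.submatrix (Subtype.val : T → Fin n) id * (E.submatrix (Subtype.val : T → Fin n) id)ᴴ := by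
    ext j l
    have := congrFun₂ hFE j.1 l.1
    simp only [mul_apply, Matrix.add_apply, one_apply, submatrix_apply, conjTranspose_apply,
      Subtype.coe_inj, id] at this ⊢
    exact this
  obtain ⟨q, hq0, hq1, hqs, hq⟩ := exists_weights_le_col_normSq hT
  rw [Fintype.card_coe] at hqs
  have hk : T.card ≤ n := by simpa using T.card_le_univ
  calc 2 * ∑ j : Fin n with j.val < T.card, δ j ≤ 2 * ∑ i, δ i * q i := by
        gcongr
        exact sum_smallest_le_sum_weights hk hδ hq0 hq1 hqs
    _ ≤ 2 * ∑ i, δ i * ∑ j ∈ T, Complex.normSq (F j i) := by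
        gcongr with i _
        · exact h0 i
        · exact (hq i).trans_eq (Finset.sum_coe_sort T fun j => Complex.normSq (F j i))
    _ = ∑ j ∈ T, ∑ i, δ i * (2 * Complex.normSq (F j i)) := by
        simp only [Finset.mul_sum]
        rw [Finset.sum_comm]
        exact Finset.sum_congr rfl fun _ _ => Finset.sum_congr rfl fun _ _ => by ring
    _ ≤ _ := by
        refine Finset.sum_le_sum fun j _ => ?_
        rw [diag_symplectic_congr, diag_symplectic_congr, ← Finset.sum_add_distrib]
        refine Finset.sum_le_sum fun i _ => ?_
        rw [← mul_add]
        exact mul_le_mul_of_nonneg_left (hF j i) (h0 i)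

/-- The case of the geometric mean, for an arbitrary set of diagonal positions. -/
theorem sum_smallest_le_sum_sqrt {n : ℕ} {A : Matrix (Fin n ⊕ Fin n) (Fin n ⊕ Fin n) ℝ}
    (hA : A.PosDef) {δ : Fin n → ℝ} (h : IsSymplecticEigenvalueVector A δ) (T : Finset (Fin n)) :
    ∑ j : Fin n with j.val < T.card, δ j ≤
      ∑ j ∈ T, √(A (.inl j) (.inl j) * A (.inr j) (.inr j)) := by
  obtain ⟨hδ, W, hW, hAW⟩ := h
  have h0 (i : Fin n) : 0 ≤ δ i := by
    have hWu : IsUnit W := (isUnit_iff_isUnit_det W).mpr (SymplecticGroup.symplectic_det hW)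
    have hAp := hA
    rw [hAW, ← conjTranspose_eq_transpose_of_trivial, ← star_eq_conjTranspose,
      IsUnit.posDef_star_right_conjugate_iff hWu, fromBlocks_diagonal, posDef_diagonal_iff] at hAp
    exact (hAp (.inl i)).le
  -- With `r = √(b / a)`, the diagonal rescaling by `√r` and `1 / √r` turns `a` and `b` into `√(a b)`.
  set r : Fin n → ℝ := fun j => √(A (.inr j) (.inr j)) / √(A (.inl j) (.inl j))
  have ha (j : Fin n) : 0 < √(A (.inl j) (.inl j)) := Real.sqrt_pos.mpr hA.diag_pos
  have hb (j : Fin n) : 0 < √(A (.inr j) (.inr j)) := Real.sqrt_pos.mpr hA.diag_pos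
  have hr (j : Fin n) : 0 < r j := div_pos (hb j) (ha j)
  set L : Matrix (Fin n ⊕ Fin n) (Fin n ⊕ Fin n) ℝ :=
    fromBlocks (diagonal fun j => √(r j)) 0 0 (diagonal fun j => (√(r j))⁻¹) with hL
  have hLs : L ∈ symplecticGroup (Fin n) ℝ := by
    rw [SymplecticGroup.mem_iff, hL, J]
    have hneg : (diagonal fun _ : Fin n => (-1 : ℝ)) = -1 := by rw [← diagonal_neg, diagonal_one]
    simp [fromBlocks_multiply, fromBlocks_transpose, -fromBlocks_diagonal,
      (Real.sqrt_pos.mpr (hr _)).ne', hneg]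
  have key := two_mul_sum_smallest_le_trace (mul_mem hLs hW) hδ h0 T
  have hcongr : L * W * fromBlocks (diagonal δ) 0 0 (diagonal δ) * (L * W)ᵀ = L * A * Lᵀ := by
    rw [hAW]; simp only [transpose_mul, Matrix.mul_assoc]
  rw [hcongr] at key
  have hdiag (j : Fin n) : (L * A * Lᵀ) (.inl j) (.inl j) + (L * A * Lᵀ) (.inr j) (.inr j) =
      2 * √(A (.inl j) (.inl j) * A (.inr j) (.inr j)) := by
    rw [Real.sqrt_mul hA.diag_pos.le]
    have h1 := Real.mul_self_sqrt (hA.diag_pos (i := .inl j)).le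
    have h2 := Real.mul_self_sqrt (hA.diag_pos (i := .inr j)).le
    have h3 := Real.mul_self_sqrt (hr j).le
    have e1 : (L * A * Lᵀ) (.inl j) (.inl j) = r j * A (.inl j) (.inl j) := by
      rw [hL, fromBlocks_diagonal, diagonal_transpose, mul_diagonal, diagonal_mul, ← h3]
      simp only [Sum.elim_inl]; ring
    have e2 : (L * A * Lᵀ) (.inr j) (.inr j) = (r j)⁻¹ * A (.inr j) (.inr j) := by
      rw [hL, fromBlocks_diagonal, diagonal_transpose, mul_diagonal, diagonal_mul, ← h3]
      simp only [Sum.elim_inr, mul_inv]; ring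
    have := (ha j).ne'
    have := (hb j).ne'
    have e3 : r j * A (.inl j) (.inl j) = √(A (.inl j) (.inl j)) * √(A (.inr j) (.inr j)) := by
      calc _ = r j * (√(A (.inl j) (.inl j)) * √(A (.inl j) (.inl j))) := by rw [h1]
        _ = _ := by simp only [r]; field_simp
    have e4 : (r j)⁻¹ * A (.inr j) (.inr j) = √(A (.inl j) (.inl j)) * √(A (.inr j) (.inr j)) := by
      calc _ = (r j)⁻¹ * (√(A (.inr j) (.inr j)) * √(A (.inr j) (.inr j))) := by rw [h2]
        _ = _ := by simp only [r]; field_simp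
    rw [e1, e2, e3, e4]
    ring
  simp only [hdiag, ← Finset.mul_sum] at key
  linarith

end SymplecticSchur

theorem theorem6p2 (M : ℝ → ℝ → ℝ) (hM : SymplecticSchur.IsMean M)
    (hgeom : ∀ a b : ℝ, 0 < a → 0 < b → Real.sqrt (a * b) ≤ M a b)
    (n : ℕ) (A : Matrix (Fin n ⊕ Fin n) (Fin n ⊕ Fin n) ℝ) (hA : A.PosDef) :
    (∃ δ : Fin n → ℝ, SymplecticSchur.IsSymplecticEigenvalueVector A δ) ∧
      ∀ δ : Fin n → ℝ, SymplecticSchur.IsSymplecticEigenvalueVector A δ →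
        SymplecticSchur.WeaklySupermajorizedBy (SymplecticSchur.sympDiag M A) δ := by
  refine ⟨SymplecticSchur.exists_isSymplecticEigenvalueVector hA, fun δ hδ k _ hk => ?_⟩
  set σ := Tuple.sort (SymplecticSchur.sympDiag M A)
  -- The positions of the `k` smallest entries of the symplectic diagonal.
  set T : Finset (Fin n) := (Finset.univ.filter fun j : Fin n => j.val < k).map σ.toEmbedding
  have hT : T.card = k := by simp [T, Fin.card_filter_val_lt, hk]
  have hinc : SymplecticSchur.increasing δ = δ := by
    rw [SymplecticSchur.increasing, Tuple.sort_eq_refl_iff_monotone.mpr hδ.1]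
    rfl
  rw [hinc]
  calc ∑ j : Fin n with j.val < k, δ j
      ≤ ∑ j ∈ T, √(A (.inl j) (.inl j) * A (.inr j) (.inr j)) := by
        simpa only [hT] using SymplecticSchur.sum_smallest_le_sum_sqrt hA hδ T
    _ ≤ ∑ j ∈ T, SymplecticSchur.sympDiag M A j :=
        Finset.sum_le_sum fun j _ => hgeom _ _ hA.diag_pos hA.diag_pos
    _ = ∑ j : Fin n with j.val < k, SymplecticSchur.increasing (SymplecticSchur.sympDiag M A) j :=
        Finset.sum_map _ _ _
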